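/- Let \(m\ge 0\), \(\xi_0>m\), \(a\neq 0\) be real, let \(\omega_0=\sqrt{\xi_0^2+m^2}\), and let \(R>\frac{\pi}{2\omega_0}\). On Minkowski spacetime with coordinates \((t,x,y,z)\) and metric \(-dt^2+dx^2+dy^2+dz^2\), associate to a smooth function \(\Psi=\Psi(t,x)\) the two-form \[ F_\Psi=d\Psi\wedge dy+m\Psi\,dt\wedge dx , \] with electric field \(E_i=F_{ti}\), magnetic field given by \(F_{ij}=\epsilon_{ijk}B^k\), invariant \(\Delta=|B|^2-|E|^2\) and energy density \(\mathcal E=\frac12(|E|^2+|B|^2)\); these depend only on \((t,x)\), and \(\Delta=\Psi_x^2-\Psi_t^2-m^2\Psi^2\). There exist Schwartz functions \(\chi\in\mathcal S(\mathbb R)\), real-valued, with \(\chi(x)=1\) for \(|x|\le R\); and for every such \(\chi\) the Cauchy problem \[ \Psi_{tt}-\Psi_{xx}+m^2\Psi=0,\qquad \Psi(0,x)=\chi(x)\,a\cos\!\left(\xi_0x-\tfrac{\pi}{4}\right),\qquad \Psi_t(0,x)=0, \] has a global solution \(\Psi\in C^\infty(\mathbb R^2)\), unique among \(C^2\) solutions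 on \(\mathbb R^2\), with the following properties. 1. \(F=F_\Psi\) solves the force-free equations: \(dF=0\) and \(F_{\mu\nu}J^\nu=0\), where \(J^\mu=\partial_\nu F^{\nu\mu}\). 2. \(F_\Psi\) has finite energy per unit transverse area: \(\int_{\mathbb R}\mathcal E(t,x)\,dx<\infty\) for every \(t\in\mathbb R\). 3. \(\Psi(t,x)=a\cos(\xi_0x-\frac{\pi}{4})\cos(\omega_0t)\) whenever \(t\ge 0\) and \(|x|\le R-t\); and for \(0\le t<R\), \[ \Delta(t,0)=\tfrac{a^2}{2}(\xi_0^2-m^2)\cos^2(\omega_0t)-\tfrac{a^2}{2}(\xi_0^2+m^2)\sin^2(\omega_0t). \] 4. The field type at \(x=0\) changes from magnetically dominated to electrically dominated: \[ \Delta(0,0)>0,\qquad \Delta\!\left(\tfrac{\pi}{2\omega_0},0\right)<0 . \] -/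

import Mathlib

open scoped ContDiff SchwartzMap

noncomputable section

namespace ForceFree

/-- Points of Minkowski spacetime in the coordinates `(t, x, y, z) = (p 0, p 1, p 2, p 3)`. -/
abbrev Spacetime : Type := Fin 4 → ℝ

/-- Partial derivative in the coordinate direction `μ`. -/
def pd (μ : Fin 4) (f : Spacetime → ℝ) (p : Spacetime) : ℝ :=
  fderiv ℝ f p (Pi.single μ 1)

/-- Components of the Minkowski metric `-dt² + dx² + dy² + dz²` (equal to those of its inverse). -/
def eta (μ ν : Fin 4) : ℝ :=
  if μ = ν then (if μ = 0 then -1 else 1) else 0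

/-- Components `F_{μν}` of a field of bilinear forms on spacetime. -/
abbrev FieldTensor : Type := Spacetime → Fin 4 → Fin 4 → ℝ

/-- Components of the coordinate covector `dx^μ`. -/
def coord (μ : Fin 4) : Fin 4 → ℝ := Pi.single μ 1

/-- Components of the differential of a function at a point. -/
def differential (f : Spacetime → ℝ) (p : Spacetime) : Fin 4 → ℝ := fun μ => pd μ f p

/-- Components of the wedge product of two covectors. -/
def wedge (α β : Fin 4 → ℝ) (μ ν : Fin 4) : ℝ := α μ * β ν - α ν * β μ

/-- The components `F^{μν}`, with both indices raised by the Minkowski metric. -/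
def raised (F : FieldTensor) (p : Spacetime) (μ ν : Fin 4) : ℝ :=
  ∑ α, ∑ β, eta μ α * eta ν β * F p α β

/-- The current `J^μ = ∂_ν F^{νμ}`. -/
def current (F : FieldTensor) (p : Spacetime) (μ : Fin 4) : ℝ :=
  ∑ ν, pd ν (fun q => raised F q ν μ) p

/-- Smooth solutions `F` of the force-free equations on Minkowski spacetime: a smooth two-form
with `dF = 0`, whose current `J` satisfies `F_{μν} J^ν = 0`. -/
structure IsForceFree (F : FieldTensor) : Prop where
  smooth : ∀ μ ν, ContDiff ℝ ∞ (fun p => F p μ ν)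
  antisymm : ∀ p μ ν, F p μ ν = -F p ν μ
  closed : ∀ p l μ ν, pd l (fun q => F q μ ν) p + pd μ (fun q => F q ν l) p
    + pd ν (fun q => F q l μ) p = 0
  force_free : ∀ p μ, ∑ ν, F p μ ν * current F p ν = 0

/-- The electric field `E_i = F_{ti}`. -/
def electric (F : FieldTensor) (p : Spacetime) : Fin 3 → ℝ :=
  ![F p 0 1, F p 0 2, F p 0 3]

/-- The magnetic field, `F_{ij} = ε_{ijk} B^k`. -/
def magnetic (F : FieldTensor) (p : Spacetime) : Fin 3 → ℝ :=
  ![F p 2 3, F p 3 1, F p 1 2]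

/-- The invariant `Δ = |B|² - |E|²`: the field is magnetically dominated, null or electrically
dominated at `p` according to whether this is positive, zero or negative. -/
def invariant (F : FieldTensor) (p : Spacetime) : ℝ :=
  ∑ i, magnetic F p i ^ 2 - ∑ i, electric F p i ^ 2

/-- The electromagnetic energy density `(|E|² + |B|²) / 2`. -/
def energyDensity (F : FieldTensor) (p : Spacetime) : ℝ :=
  (∑ i, electric F p i ^ 2 + ∑ i, magnetic F p i ^ 2) / 2

/-- The energy per unit transverse area at time `t` and transverse position `(y, z)`:
the integral of the energy density over the `x`-axis. -/
def energyPerArea (F : FieldTensor) (t y z : ℝ) : ENNReal :=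
  ∫⁻ x : ℝ, ENNReal.ofReal (energyDensity F ![t, x, y, z])

/-- The field `F = dΨ ∧ dy + h(Ψ) dt ∧ dx` of a scalar function `Ψ(t, x)`. -/
def ansatz (h : ℝ → ℝ) (Ψ : ℝ → ℝ → ℝ) : FieldTensor := fun p μ ν =>
  wedge (differential (fun q => Ψ (q 0) (q 1)) p) (coord 2) μ ν
    + h (Ψ (p 0) (p 1)) * wedge (coord 0) (coord 1) μ ν

/-- `Ψ` is a global classical (`C²`) solution of the Cauchy problem
`Ψ_tt - Ψ_xx + m² Ψ = 0`, `Ψ(0, ·) = Ψ₀`, `Ψ_t(0, ·) = Ψ₁`. -/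
structure IsKleinGordonSolution (m : ℝ) (Ψ₀ Ψ₁ : ℝ → ℝ) (Ψ : ℝ → ℝ → ℝ) : Prop where
  contDiff : ContDiff ℝ 2 (fun q : ℝ × ℝ => Ψ q.1 q.2)
  equation : ∀ t x, iteratedDeriv 2 (fun s => Ψ s x) t - iteratedDeriv 2 (fun r => Ψ t r) x
    + m ^ 2 * Ψ t x = 0
  init : ∀ x, Ψ 0 x = Ψ₀ x
  init_deriv : ∀ x, deriv (fun s => Ψ s x) 0 = Ψ₁ x

/-- The monochromatic wave `a cos(ξ₀ x - π/4) cos(ω₀ t)`. -/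
def mono (a ξ₀ ω₀ t x : ℝ) : ℝ :=
  a * Real.cos (ξ₀ * x - Real.pi / 4) * Real.cos (ω₀ * t)

end ForceFree

end

/-! The nonzero components of `F` are `F_ty = Ψ_t`, `F_xy = Ψ_x`, `F_tx = mΨ` and their negatives.
This form is closed, and the force `F_{μν} J^ν` has `t` and `x` components `-Ψ_t` and `-Ψ_x` times
`Ψ_tt - Ψ_xx + m²Ψ`, the others vanishing identically. So every smooth Klein-Gordon solution gives a
force-free field (`isForceFree_ansatz`). Klein-Gordon waves propagate at speed at most one, so
cutting off a monochromatic wave outside `[-R, R]` does not affect it where `|x| ≤ R - t`. There the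
phase `π/4` gives `Ψ_x²`, `Ψ_t²` and `Ψ²` the same weight `a²/2` at `x = 0`, and `Δ` changes sign
within the quarter period `π/(2ω₀) < R`.

One energy estimate, `exists_energy_potential`, yields finite propagation speed and uniqueness
(`eq_zero_of_data_eq_zero`) as well as finite energy at later times (`integrable_energy`). Existence
(`exists_isKleinGordonSolution`) comes from the Fourier transform of a Schwartz density carried by
the mass hyperbola. -/

noncomputable section

open Filter Topology MeasureTheory Set

namespace ForceFree

/-! ### Calculus on the `(t, x)`-plane. -/

/-- Partial derivative in the first variable of a function on the `(t, x)`-plane. -/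
def dt (u : ℝ × ℝ → ℝ) (q : ℝ × ℝ) : ℝ := fderiv ℝ u q (1, 0)

/-- Partial derivative in the second variable of a function on the `(t, x)`-plane. -/
def dx (u : ℝ × ℝ → ℝ) (q : ℝ × ℝ) : ℝ := fderiv ℝ u q (0, 1)

theorem contDiff_dt {u : ℝ × ℝ → ℝ} {n m : WithTop ℕ∞} (hu : ContDiff ℝ n u) (h : m + 1 ≤ n) :
    ContDiff ℝ m (dt u) :=
  (hu.fderiv_right h).clm_apply contDiff_const

theorem contDiff_dx {u : ℝ × ℝ → ℝ} {n m : WithTop ℕ∞} (hu : ContDiff ℝ n u) (h : m + 1 ≤ n) :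
    ContDiff ℝ m (dx u) :=
  (hu.fderiv_right h).clm_apply contDiff_const

theorem fderiv_plane_apply (u : ℝ × ℝ → ℝ) (q v : ℝ × ℝ) :
    fderiv ℝ u q v = v.1 * dt u q + v.2 * dx u q := by
  have : v = v.1 • ((1, 0) : ℝ × ℝ) + v.2 • ((0, 1) : ℝ × ℝ) := by ext <;> simp
  conv_lhs => rw [this]
  simp only [map_add, map_smul, dt, dx, smul_eq_mul]

theorem hasDerivAt_comp_plane {u : ℝ × ℝ → ℝ} (hu : Differentiable ℝ u) {f g : ℝ → ℝ}
    {f' g' s : ℝ} (hf : HasDerivAt f f' s) (hg : HasDerivAt g g' s) :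
    HasDerivAt (fun r => u (f r, g r)) (f' * dt u (f s, g s) + g' * dx u (f s, g s)) s := by
  have := (hu (f s, g s)).hasFDerivAt.comp_hasDerivAt s (hf.prodMk hg)
  rwa [fderiv_plane_apply] at this

theorem hasDerivAt_fst {u : ℝ × ℝ → ℝ} (hu : Differentiable ℝ u) (t x : ℝ) :
    HasDerivAt (fun s => u (s, x)) (dt u (t, x)) t := by
  simpa using hasDerivAt_comp_plane hu (hasDerivAt_id t) (hasDerivAt_const t x)

theorem hasDerivAt_snd {u : ℝ × ℝ → ℝ} (hu : Differentiable ℝ u) (t x : ℝ) :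
    HasDerivAt (fun r => u (t, r)) (dx u (t, x)) x := by
  simpa using hasDerivAt_comp_plane hu (hasDerivAt_const x t) (hasDerivAt_id x)

theorem dt_dx_comm {u : ℝ × ℝ → ℝ} (hu : ContDiff ℝ 2 u) (q : ℝ × ℝ) :
    dt (dx u) q = dx (dt u) q := by
  have hd : DifferentiableAt ℝ (fderiv ℝ u) q :=
    (hu.fderiv_right (m := 1) (by norm_num)).differentiable (by norm_num) q
  have hs : IsSymmSndFDerivAt ℝ u q := hu.contDiffAt.isSymmSndFDerivAt (by simp)
  have h (v w : ℝ × ℝ) : fderiv ℝ (fun p => fderiv ℝ u p v) q w = fderiv ℝ (fderiv ℝ u) q w v := by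
    rw [fderiv_clm_apply hd (differentiableAt_const v)]
    simp
  unfold dt dx
  rw [h, h]
  exact hs _ _

theorem iteratedDeriv_two_fst {u : ℝ × ℝ → ℝ} (hu : ContDiff ℝ 2 u) (t x : ℝ) :
    iteratedDeriv 2 (fun s => u (s, x)) t = dt (dt u) (t, x) := by
  have h1 : deriv (fun s => u (s, x)) = fun s => dt u (s, x) :=
    funext fun s => (hasDerivAt_fst (hu.differentiable (by norm_num)) s x).deriv
  rw [iteratedDeriv_succ, iteratedDeriv_one, h1]
  exact (hasDerivAt_fst ((contDiff_dt (m := 1) hu (by norm_num)).differentiable (by norm_num))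
    t x).deriv

theorem iteratedDeriv_two_snd {u : ℝ × ℝ → ℝ} (hu : ContDiff ℝ 2 u) (t x : ℝ) :
    iteratedDeriv 2 (fun r => u (t, r)) x = dx (dx u) (t, x) := by
  have h1 : deriv (fun r => u (t, r)) = fun r => dx u (t, r) :=
    funext fun s => (hasDerivAt_snd (hu.differentiable (by norm_num)) t s).deriv
  rw [iteratedDeriv_succ, iteratedDeriv_one, h1]
  exact (hasDerivAt_snd ((contDiff_dx (m := 1) hu (by norm_num)).differentiable (by norm_num))
    t x).deriv

/-- A closed `C¹` one-form `p dt + e dx` on the plane is exact. -/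
theorem exists_potential {p e : ℝ × ℝ → ℝ} (hp : ContDiff ℝ 1 p) (he : ContDiff ℝ 1 e)
    (h : ∀ q, dt e q = dx p q) :
    ∃ P : ℝ × ℝ → ℝ, Differentiable ℝ P ∧ ∀ q, dt P q = p q ∧ dx P q = e q := by
  let w : ℝ × ℝ → ℝ × ℝ →L[ℝ] ℝ := fun q =>
    p q • ContinuousLinearMap.fst ℝ ℝ ℝ + e q • ContinuousLinearMap.snd ℝ ℝ ℝ
  have hpd := hp.differentiable (by norm_num)
  have hed := he.differentiable (by norm_num)
  have hw (q : ℝ × ℝ) : HasFDerivAt w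
      ((fderiv ℝ p q).smulRight (ContinuousLinearMap.fst ℝ ℝ ℝ)
        + (fderiv ℝ e q).smulRight (ContinuousLinearMap.snd ℝ ℝ ℝ)) q :=
    ((hpd q).hasFDerivAt.smul_const (ContinuousLinearMap.fst ℝ ℝ ℝ)).add
      ((hed q).hasFDerivAt.smul_const (ContinuousLinearMap.snd ℝ ℝ ℝ))
  obtain ⟨P, hP⟩ := (convex_univ (𝕜 := ℝ) (E := ℝ × ℝ)).exists_forall_hasFDerivAt_of_fderiv_symmetric
    isOpen_univ (show DifferentiableOn ℝ w univ from
      fun q _ => (hw q).differentiableAt.differentiableWithinAt) (by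
      intro q _ x y
      rw [(hw q).fderiv]
      simp only [add_apply, ContinuousLinearMap.smulRight_apply, fderiv_plane_apply, h,
        smul_eq_mul, smul_apply, ContinuousLinearMap.coe_fst',
        ContinuousLinearMap.coe_snd']
      ring)
  refine ⟨P, fun q => (hP q trivial).differentiableAt, fun q => ?_⟩
  simp [dt, dx, (hP q trivial).fderiv, w]

/-! ### Energy estimates and the domain of dependence. -/

/-- Energy density of the Klein-Gordon field `u`. -/
def energy (m : ℝ) (u : ℝ × ℝ → ℝ) (q : ℝ × ℝ) : ℝ :=
  (dt u q ^ 2 + dx u q ^ 2 + m ^ 2 * u q ^ 2) / 2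

theorem energy_nonneg (m : ℝ) (u : ℝ × ℝ → ℝ) (q : ℝ × ℝ) : 0 ≤ energy m u q := by
  unfold energy; positivity

theorem continuous_energy (m : ℝ) {u : ℝ × ℝ → ℝ} (hu : ContDiff ℝ 1 u) :
    Continuous (energy m u) := by
  have h1 := (contDiff_dt (m := 0) hu (by norm_num)).continuous
  have h2 := (contDiff_dx (m := 0) hu (by norm_num)).continuous
  have h3 := hu.continuous
  unfold energy
  fun_prop

/-- Local energy estimate: the energy of a Klein-Gordon field has a potential `P` (so that
`P (t, b) - P (t, a)` is the energy in `[a, b]` at time `t`), and the energy inside a shrinking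
light cone does not increase. -/
theorem exists_energy_potential {m : ℝ} {u : ℝ × ℝ → ℝ} (hu : ContDiff ℝ 2 u)
    (h : ∀ q, dt (dt u) q - dx (dx u) q + m ^ 2 * u q = 0) :
    ∃ P : ℝ × ℝ → ℝ, (∀ t x, HasDerivAt (fun r => P (t, r)) (energy m u (t, x)) x) ∧
      ∀ a b s t, s ≤ t →
        P (t, b - t) - P (t, a + t) ≤ P (s, b - s) - P (s, a + s) := by
  have hu1 : Differentiable ℝ u := hu.differentiable (by norm_num)
  have ht := contDiff_dt (m := 1) hu (by norm_num)
  have hx := contDiff_dx (m := 1) hu (by norm_num)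
  have htd := ht.differentiable (by norm_num)
  have hxd := hx.differentiable (by norm_num)
  have he : ContDiff ℝ 1 (energy m u) := by
    have := hu.of_le (m := 1) (by norm_num)
    unfold energy
    fun_prop
  have hp : ContDiff ℝ 1 (fun q => dt u q * dx u q) := ht.mul hx
  -- Local conservation of energy: the Klein-Gordon equation multiplied by `u_t`. It makes `u_t u_x
  -- dt + energy dx` a closed form.
  have hclosed (q : ℝ × ℝ) : dt (energy m u) q = dx (fun q => dt u q * dx u q) q := by
    obtain ⟨t, x⟩ := q
    rw [← (hasDerivAt_fst (he.differentiable (by norm_num)) t x).deriv,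
      ← (hasDerivAt_snd (hp.differentiable (by norm_num)) t x).deriv]
    have h1 := ((((hasDerivAt_fst htd t x).pow 2).add ((hasDerivAt_fst hxd t x).pow 2)).add
      (((hasDerivAt_fst hu1 t x).pow 2).const_mul (m ^ 2))).div_const 2
    have h2 := (hasDerivAt_snd htd t x).mul (hasDerivAt_snd hxd t x)
    refine h1.deriv.trans (Eq.trans ?_ h2.deriv.symm)
    have h3 := h (t, x)
    rw [dt_dx_comm hu]
    simp only [Nat.cast_ofNat, Nat.add_one_sub_one, pow_one]
    linear_combination dt u (t, x) * h3
  obtain ⟨P, hPd, hP⟩ := exists_potential hp he hclosed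
  refine ⟨P, fun t x => (hP (t, x)).2 ▸ hasDerivAt_snd hPd t x, fun a b s t hst => ?_⟩
  have hd (r : ℝ) := (hasDerivAt_comp_plane hPd (hasDerivAt_id r)
      ((hasDerivAt_const r b).sub (hasDerivAt_id r))).sub
    (hasDerivAt_comp_plane hPd (hasDerivAt_id r)
      ((hasDerivAt_const r a).add (hasDerivAt_id r)))
  refine antitone_of_hasDerivAt_nonpos hd (fun r => ?_) hst
  simp only [hP, energy, Pi.zero_apply, Pi.sub_apply, Pi.add_apply, id]
  -- The flux through the two characteristic sides is `-((u_t - u_x)² + m²u²)/2` on the right and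
  -- `-((u_t + u_x)² + m²u²)/2` on the left.
  nlinarith [sq_nonneg (dt u (r, b - r) - dx u (r, b - r)),
    sq_nonneg (dt u (r, a + r) + dx u (r, a + r)),
    mul_nonneg (sq_nonneg m) (sq_nonneg (u (r, b - r))),
    mul_nonneg (sq_nonneg m) (sq_nonneg (u (r, a + r)))]

/-- Domain of dependence: a Klein-Gordon field whose Cauchy data vanish on the base of a light
cone vanishes at its tip. -/
theorem eq_zero_of_data_eq_zero {m : ℝ} {u : ℝ × ℝ → ℝ} (hu : ContDiff ℝ 2 u)
    (h : ∀ q, dt (dt u) q - dx (dx u) q + m ^ 2 * u q = 0) {t x : ℝ} (ht : 0 ≤ t)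
    (h0 : ∀ y, |y - x| ≤ t → u (0, y) = 0) (h1 : ∀ y, |y - x| ≤ t → dt u (0, y) = 0) :
    u (t, x) = 0 := by
  obtain ⟨P, hPx, hP⟩ := exists_energy_potential hu h
  have hu1 : Differentiable ℝ u := hu.differentiable (by norm_num)
  have hbase : P (0, x + t) - P (0, x - t) = 0 := by
    have hdiff : Differentiable ℝ fun r => P (0, r) := fun r => (hPx 0 r).differentiableAt
    have := (antitoneOn_of_deriv_nonpos (D := Icc (x - t) (x + t)) (convex_Icc _ _)
      hdiff.continuous.continuousOn hdiff.differentiableOn (by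
        rw [interior_Icc]
        intro y hy
        have hy' : |y - x| ≤ t := by rw [abs_le]; constructor <;> linarith [hy.1, hy.2]
        have hux : dx u (0, y) = 0 := by
          rw [← (hasDerivAt_snd hu1 0 y).deriv]
          have : (fun r => u (0, r)) =ᶠ[𝓝 y] fun _ => 0 := by
            filter_upwards [isOpen_Ioo.mem_nhds hy] with z hz
            exact h0 z (by rw [abs_le]; constructor <;> linarith [hz.1, hz.2])
          rw [this.deriv_eq, deriv_const]
        rw [(hPx 0 y).deriv, energy, h0 y hy', h1 y hy', hux]
        simp)) (left_mem_Icc.2 (by linarith)) (right_mem_Icc.2 (by linarith)) (by linarith)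
    have hm : Monotone fun r => P (0, r) :=
      monotone_of_hasDerivAt_nonneg (hPx 0) (fun y => energy_nonneg m u (0, y))
    have := hm (show x - t ≤ x + t by linarith)
    simp only at *
    linarith
  -- The energy in the slice at time `s` is squeezed between `0` and the zero energy of the base, so
  -- `P (s, ·)` is constant near `x` and its derivative, the energy density, vanishes there.
  have hinside (s : ℝ) (hs : 0 ≤ s) (hst : s < t) : dt u (s, x) = 0 := by
    have hm : Monotone fun r => P (s, r) :=
      monotone_of_hasDerivAt_nonneg (hPx s) (fun y => energy_nonneg m u (s, y))
    have hle := hP (x - t) (x + t) 0 s hs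
    simp only [add_zero, sub_zero, hbase] at hle
    have hconst : (fun r => P (s, r)) =ᶠ[𝓝 x] fun _ => P (s, x - t + s) := by
      filter_upwards [isOpen_Ioo.mem_nhds
        (show x ∈ Ioo (x - t + s) (x + t - s) by constructor <;> linarith)] with z hz
      have h2 := hm hz.1.le
      have h3 := hm hz.2.le
      simp only at h2 h3
      linarith
    have he : energy m u (s, x) = 0 := by
      rw [← (hPx s x).deriv, hconst.deriv_eq, deriv_const]
    have h4 : dt u (s, x) ^ 2 = 0 := by
      unfold energy at he
      nlinarith [sq_nonneg (dt u (s, x)), sq_nonneg (dx u (s, x)),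
        mul_nonneg (sq_nonneg m) (sq_nonneg (u (s, x)))]
    exact pow_eq_zero_iff (two_ne_zero) |>.1 h4
  -- For `m = 0` the energy does not control `u` itself, so `u_t = 0` is integrated up the axis of
  -- the cone.
  have hconst := constant_of_has_deriv_right_zero (f := fun s => u (s, x)) (a := 0) (b := t)
    (by have := hu.continuous; fun_prop)
    (fun s hs => by
      have := hasDerivAt_fst hu1 s x
      rw [hinside s hs.1 hs.2] at this
      exact this.hasDerivWithinAt) t (right_mem_Icc.2 ht)
  simpa [h0 x (by simpa using ht)] using hconst

/-- Finite total energy at time zero implies finite total energy at later times. -/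
theorem integrable_energy {m : ℝ} {u : ℝ × ℝ → ℝ} (hu : ContDiff ℝ 2 u)
    (h : ∀ q, dt (dt u) q - dx (dx u) q + m ^ 2 * u q = 0)
    (h0 : Integrable fun x => energy m u (0, x)) {t : ℝ} (ht : 0 ≤ t) :
    Integrable fun x => energy m u (t, x) := by
  obtain ⟨P, hPx, hP⟩ := exists_energy_potential hu h
  have hc := continuous_energy m (hu.of_le (m := 1) (by norm_num))
  have hcs (s : ℝ) : Continuous fun x => energy m u (s, x) := by fun_prop
  have hint (s a b : ℝ) : ∫ x in a..b, energy m u (s, x) = P (s, b) - P (s, a) :=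
    intervalIntegral.integral_eq_sub_of_hasDerivAt (fun x _ => hPx s x)
      ((hcs s).intervalIntegrable _ _)
  refine integrable_of_intervalIntegral_norm_bounded (l := atTop) (a := fun L : ℝ => -L)
    (b := fun L => L) (∫ x, energy m u (0, x))
    (fun L => ((hcs t).integrableOn_Icc).mono_set Ioc_subset_Icc_self) tendsto_neg_atTop_atBot
    tendsto_id ?_
  filter_upwards [eventually_ge_atTop 0] with L hL
  simp_rw [Real.norm_of_nonneg (energy_nonneg m u _)]
  -- The cone over `[-L - t, L + t]` has exactly `[-L, L]` as its slice at time `t`.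
  have h1 := hP (-L - t) (L + t) 0 t ht
  simp only [add_sub_cancel_right, sub_add_cancel, add_zero, sub_zero] at h1
  rw [hint]
  refine h1.trans ?_
  rw [← hint, intervalIntegral.integral_of_le (by linarith)]
  exact setIntegral_le_integral h0 (ae_of_all _ fun x => energy_nonneg m u (0, x))

/-! ### Linearity, time reversal and uniqueness for the Cauchy problem. -/

namespace IsKleinGordonSolution

variable {m : ℝ} {f g f' g' : ℝ → ℝ} {Φ Ψ : ℝ → ℝ → ℝ}

theorem box_eq_zero (h : IsKleinGordonSolution m f g Ψ) (q : ℝ × ℝ) :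
    dt (dt fun q : ℝ × ℝ => Ψ q.1 q.2) q - dx (dx fun q : ℝ × ℝ => Ψ q.1 q.2) q
      + m ^ 2 * Ψ q.1 q.2 = 0 := by
  rw [← h.equation q.1 q.2, ← iteratedDeriv_two_fst h.contDiff q.1 q.2,
    ← iteratedDeriv_two_snd h.contDiff q.1 q.2]

theorem of_box {u : ℝ × ℝ → ℝ} (hu : ContDiff ℝ 2 u)
    (h : ∀ q, dt (dt u) q - dx (dx u) q + m ^ 2 * u q = 0) :
    IsKleinGordonSolution m (fun x => u (0, x)) (fun x => dt u (0, x)) fun t x => u (t, x) where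
  contDiff := hu
  equation t x := by
    rw [iteratedDeriv_two_fst hu, iteratedDeriv_two_snd hu, h]
  init _ := rfl
  init_deriv x := (hasDerivAt_fst (hu.differentiable (by norm_num)) 0 x).deriv

theorem dt_zero (h : IsKleinGordonSolution m f g Ψ) (x : ℝ) :
    dt (fun q : ℝ × ℝ => Ψ q.1 q.2) (0, x) = g x := by
  rw [← h.init_deriv x]
  exact (hasDerivAt_fst (h.contDiff.differentiable (by norm_num)) 0 x).deriv.symm

theorem contDiff_fst (h : IsKleinGordonSolution m f g Ψ) (x : ℝ) :
    ContDiff ℝ 2 fun s => Ψ s x :=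
  h.contDiff.comp (contDiff_id.prodMk contDiff_const)

theorem contDiff_snd (h : IsKleinGordonSolution m f g Ψ) (t : ℝ) :
    ContDiff ℝ 2 fun r => Ψ t r :=
  h.contDiff.comp (contDiff_const.prodMk contDiff_id)

theorem linear_combination (c d : ℝ) (h : IsKleinGordonSolution m f g Ψ)
    (h' : IsKleinGordonSolution m f' g' Φ) :
    IsKleinGordonSolution m (fun x => c * f x + d * f' x) (fun x => c * g x + d * g' x)
      (fun t x => c * Ψ t x + d * Φ t x) where
  contDiff := (contDiff_const.mul h.contDiff).add (contDiff_const.mul h'.contDiff)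
  equation t x := by
    have h1 := iteratedDeriv_add (n := 2) (x := t)
      (contDiff_const.mul (h.contDiff_fst x)).contDiffAt
      (contDiff_const.mul (h'.contDiff_fst x)).contDiffAt (f := fun s => c * Ψ s x)
      (g := fun s => d * Φ s x)
    have h2 := iteratedDeriv_add (n := 2) (x := x)
      (contDiff_const.mul (h.contDiff_snd t)).contDiffAt
      (contDiff_const.mul (h'.contDiff_snd t)).contDiffAt (f := fun r => c * Ψ t r)
      (g := fun r => d * Φ t r)
    simp only [iteratedDeriv_const_mul_field] at h1 h2
    refine (congrArg₂ (fun y z => y - z + m ^ 2 * (c * Ψ t x + d * Φ t x)) h1 h2).trans ?_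
    linear_combination c * h.equation t x + d * h'.equation t x
  init x := by rw [h.init, h'.init]
  init_deriv x := by
    rw [← h.init_deriv, ← h'.init_deriv]
    exact ((((h.contDiff_fst x).differentiable (by norm_num) 0).hasDerivAt.const_mul c).add
      (((h'.contDiff_fst x).differentiable (by norm_num) 0).hasDerivAt.const_mul d)).deriv

/-- Time reversal carries results from `t ≥ 0` to `t ≤ 0`; averaging with it also removes the
initial velocity in the existence proof. -/
theorem reflect (h : IsKleinGordonSolution m f g Ψ) :
    IsKleinGordonSolution m f (fun x => -g x) (fun t x => Ψ (-t) x) where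
  contDiff := h.contDiff.comp (_root_.contDiff_fst.neg.prodMk _root_.contDiff_snd)
  equation t x := by
    rw [iteratedDeriv_comp_neg 2 (fun s => Ψ s x)]
    simpa using h.equation (-t) x
  init x := by simp [h.init]
  init_deriv x := by
    rw [deriv_comp_neg (fun s => Ψ s x)]
    simp [h.init_deriv]

/-- Finite speed of propagation. -/
theorem eq_of_data_eq (h : IsKleinGordonSolution m f g Ψ) (h' : IsKleinGordonSolution m f' g' Φ)
    {t x : ℝ} (ht : 0 ≤ t) (hf : ∀ y, |y - x| ≤ t → f y = f' y)
    (hg : ∀ y, |y - x| ≤ t → g y = g' y) : Ψ t x = Φ t x := by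
  have hd := h.linear_combination 1 (-1) h'
  have := eq_zero_of_data_eq_zero hd.contDiff hd.box_eq_zero (t := t) (x := x) ht
    (fun y hy => by simp only [hd.init, hf y hy]; ring)
    (fun y hy => by rw [hd.dt_zero, hg y hy]; ring)
  simp only at this
  linarith

theorem unique (h : IsKleinGordonSolution m f g Ψ) (h' : IsKleinGordonSolution m f g Φ) :
    Ψ = Φ := by
  funext t x
  rcases le_total 0 t with ht | ht
  · exact h.eq_of_data_eq h' ht (fun _ _ => rfl) (fun _ _ => rfl)
  · simpa using h.reflect.eq_of_data_eq h'.reflect (t := -t) (x := x) (by linarith)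
      (fun _ _ => rfl) (fun _ _ => rfl)

end IsKleinGordonSolution

/-! ### The field tensor of the ansatz. -/

/-- The function `Ψ` read as a function on the `(t, x)`-plane. -/
abbrev onPlane (Ψ : ℝ → ℝ → ℝ) : ℝ × ℝ → ℝ := fun q => Ψ q.1 q.2

theorem pd_plane {u : ℝ × ℝ → ℝ} (hu : Differentiable ℝ u) (μ : Fin 4) (p : Spacetime) :
    pd μ (fun q => u (q 0, q 1)) p =
      coord 0 μ * dt u (p 0, p 1) + coord 1 μ * dx u (p 0, p 1) := by
  have h := (hu (p 0, p 1)).hasFDerivAt.comp p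
    (((ContinuousLinearMap.proj (R := ℝ) (φ := fun _ : Fin 4 => ℝ) 0).hasFDerivAt (x := p)).prodMk
      ((ContinuousLinearMap.proj (R := ℝ) (φ := fun _ : Fin 4 => ℝ) 1).hasFDerivAt (x := p)))
  have h' : HasFDerivAt (fun q : Spacetime => u (q 0, q 1)) _ p := h
  rw [pd, h'.fderiv, ContinuousLinearMap.comp_apply, fderiv_plane_apply]
  simp [coord, Pi.single_apply, eq_comm]

theorem ansatz_eq {Ψ : ℝ → ℝ → ℝ} (hΨ : Differentiable ℝ (onPlane Ψ)) (m : ℝ) (p : Spacetime)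
    (μ ν : Fin 4) :
    ansatz (fun s => m * s) Ψ p μ ν =
      dt (onPlane Ψ) (p 0, p 1) * wedge (coord 0) (coord 2) μ ν
        + dx (onPlane Ψ) (p 0, p 1) * wedge (coord 1) (coord 2) μ ν
        + m * Ψ (p 0) (p 1) * wedge (coord 0) (coord 1) μ ν := by
  have h (μ : Fin 4) := pd_plane hΨ μ p
  simp only [onPlane] at h
  simp only [ansatz, wedge, differential, h]
  ring

theorem invariant_ansatz {Ψ : ℝ → ℝ → ℝ} (hΨ : Differentiable ℝ (onPlane Ψ)) (m : ℝ)
    (p : Spacetime) :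
    invariant (ansatz (fun s => m * s) Ψ) p =
      dx (onPlane Ψ) (p 0, p 1) ^ 2 - dt (onPlane Ψ) (p 0, p 1) ^ 2
        - m ^ 2 * Ψ (p 0) (p 1) ^ 2 := by
  simp [invariant, electric, magnetic, ansatz_eq hΨ, Fin.sum_univ_three, wedge, coord]
  ring

theorem energyDensity_ansatz {Ψ : ℝ → ℝ → ℝ} (hΨ : Differentiable ℝ (onPlane Ψ)) (m : ℝ)
    (p : Spacetime) :
    energyDensity (ansatz (fun s => m * s) Ψ) p = energy m (onPlane Ψ) (p 0, p 1) := by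
  simp [energyDensity, energy, electric, magnetic, ansatz_eq hΨ, Fin.sum_univ_three, wedge, coord]
  ring

theorem pd_ansatz {Ψ : ℝ → ℝ → ℝ} (hΨ : ContDiff ℝ 2 (onPlane Ψ)) (m : ℝ) (l μ ν : Fin 4)
    (p : Spacetime) :
    pd l (fun q => ansatz (fun s => m * s) Ψ q μ ν) p =
      coord 0 l * (dt (dt (onPlane Ψ)) (p 0, p 1) * wedge (coord 0) (coord 2) μ ν
          + dx (dt (onPlane Ψ)) (p 0, p 1) * wedge (coord 1) (coord 2) μ ν
          + m * dt (onPlane Ψ) (p 0, p 1) * wedge (coord 0) (coord 1) μ ν)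
        + coord 1 l * (dx (dt (onPlane Ψ)) (p 0, p 1) * wedge (coord 0) (coord 2) μ ν
          + dx (dx (onPlane Ψ)) (p 0, p 1) * wedge (coord 1) (coord 2) μ ν
          + m * dx (onPlane Ψ) (p 0, p 1) * wedge (coord 0) (coord 1) μ ν) := by
  have hd := hΨ.differentiable (by norm_num)
  have ht := (contDiff_dt (m := 1) hΨ (by norm_num)).differentiable (by norm_num)
  have hx := (contDiff_dx (m := 1) hΨ (by norm_num)).differentiable (by norm_num)
  let w : ℝ × ℝ → ℝ := fun q => dt (onPlane Ψ) q * wedge (coord 0) (coord 2) μ ν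
        + dx (onPlane Ψ) q * wedge (coord 1) (coord 2) μ ν
        + m * onPlane Ψ q * wedge (coord 0) (coord 1) μ ν
  have hw : Differentiable ℝ w := by unfold w; fun_prop
  have hwt := (((hasDerivAt_fst ht (p 0) (p 1)).mul_const (wedge (coord 0) (coord 2) μ ν)).add
    ((hasDerivAt_fst hx (p 0) (p 1)).mul_const (wedge (coord 1) (coord 2) μ ν))).add
    (((hasDerivAt_fst hd (p 0) (p 1)).const_mul m).mul_const (wedge (coord 0) (coord 1) μ ν))
  have hwx := (((hasDerivAt_snd ht (p 0) (p 1)).mul_const (wedge (coord 0) (coord 2) μ ν)).add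
    ((hasDerivAt_snd hx (p 0) (p 1)).mul_const (wedge (coord 1) (coord 2) μ ν))).add
    (((hasDerivAt_snd hd (p 0) (p 1)).const_mul m).mul_const (wedge (coord 0) (coord 1) μ ν))
  have h1 : (fun q => ansatz (fun s => m * s) Ψ q μ ν) = fun q => w (q 0, q 1) :=
    funext fun q => ansatz_eq hd m q μ ν
  rw [h1, pd_plane hw, (hasDerivAt_fst hw _ _).unique hwt, (hasDerivAt_snd hw _ _).unique hwx,
    dt_dx_comm hΨ]

/-- The metric is diagonal, so raising both indices only multiplies each component by a sign. -/
theorem pd_raised_ansatz {Ψ : ℝ → ℝ → ℝ} (hΨ : ContDiff ℝ ∞ (onPlane Ψ)) (m : ℝ) (l μ ν : Fin 4)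
    (p : Spacetime) :
    pd l (fun q => raised (ansatz (fun s => m * s) Ψ) q μ ν) p =
      eta μ μ * eta ν ν * pd l (fun q => ansatz (fun s => m * s) Ψ q μ ν) p := by
  have h : (fun q => raised (ansatz (fun s => m * s) Ψ) q μ ν) =
      fun q => (eta μ μ * eta ν ν) • ansatz (fun s => m * s) Ψ q μ ν := by
    funext q
    rw [raised, Finset.sum_eq_single μ, Finset.sum_eq_single ν]
    · rfl
    · intro b _ hb; simp [eta, hb.symm]
    · simp
    · intro b _ hb; simp [eta, hb.symm]
    · simp
  have hd : Differentiable ℝ fun q => ansatz (fun s => m * s) Ψ q μ ν := by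
    have h1 : Differentiable ℝ (onPlane Ψ) := hΨ.differentiable (by norm_num)
    have h2 := (contDiff_dt (m := 1) hΨ (by norm_cast)).differentiable (by norm_num)
    have h3 := (contDiff_dx (m := 1) hΨ (by norm_cast)).differentiable (by norm_num)
    have h4 : Differentiable ℝ fun q : Spacetime => Ψ (q 0) (q 1) :=
      h1.comp (g := onPlane Ψ) (f := fun q : Spacetime => (q 0, q 1)) (by fun_prop)
    simp_rw [ansatz_eq h1]
    fun_prop
  rw [h, pd, fderiv_fun_const_smul (hd p)]
  rfl

/-- The ansatz built from a smooth solution of the Klein-Gordon equation is force-free. -/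
theorem isForceFree_ansatz {m : ℝ} {Ψ : ℝ → ℝ → ℝ} (hΨ : ContDiff ℝ ∞ (onPlane Ψ))
    (h : ∀ q, dt (dt (onPlane Ψ)) q - dx (dx (onPlane Ψ)) q + m ^ 2 * onPlane Ψ q = 0) :
    IsForceFree (ansatz (fun s => m * s) Ψ) := by
  have h2 : ContDiff ℝ 2 (onPlane Ψ) := hΨ.of_le (by norm_cast)
  have h1 : Differentiable ℝ (onPlane Ψ) := hΨ.differentiable (by norm_num)
  refine ⟨fun μ ν => ?_, fun p μ ν => ?_, fun p l μ ν => ?_, fun p μ => ?_⟩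
  · simp_rw [ansatz_eq h1]
    have hpl : ContDiff ℝ ∞ fun q : Spacetime => (q 0, q 1) := by fun_prop
    have ht := (contDiff_dt (m := ∞) hΨ (by norm_cast)).comp hpl
    have hx := (contDiff_dx (m := ∞) hΨ (by norm_cast)).comp hpl
    have h0 := hΨ.comp hpl
    exact ((ht.mul contDiff_const).add (hx.mul contDiff_const)).add
      ((contDiff_const.mul h0).mul contDiff_const)
  · simp only [ansatz, wedge]; ring
  · simp only [pd_ansatz h2, wedge]; ring
  · have hp := h (p 0, p 1)
    simp only [current, pd_raised_ansatz hΨ, pd_ansatz h2]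
    simp only [ansatz_eq h1]
    simp only [onPlane] at hp
    -- The `y` component is `-mΨ_tΨ_x + mΨ_xΨ_t = 0`; the `z` component has no terms.
    fin_cases μ <;>
      simp [Fin.sum_univ_four, eta, wedge, coord, Pi.single_apply]
    · linear_combination -dt (onPlane Ψ) (p 0, p 1) * hp
    · linear_combination -dx (onPlane Ψ) (p 0, p 1) * hp
    · ring

/-! ### Existence by Fourier transform on the mass hyperbola. -/

section Existence

open VectorFourier FourierTransform

/-- The standard bilinear pairing on the plane. -/
def pairing : ℝ × ℝ →L[ℝ] ℝ × ℝ →L[ℝ] ℝ :=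
  (ContinuousLinearMap.fst ℝ ℝ ℝ).smulRight (ContinuousLinearMap.fst ℝ ℝ ℝ)
    + (ContinuousLinearMap.snd ℝ ℝ ℝ).smulRight (ContinuousLinearMap.snd ℝ ℝ ℝ)

theorem pairing_apply (v w : ℝ × ℝ) : pairing v w = v.1 * w.1 + v.2 * w.2 := by
  simp [pairing]

/-- The Fourier transform of the measure `f μ` on the plane. -/
def planeFourier (μ : Measure (ℝ × ℝ)) (f : ℝ × ℝ → ℂ) : ℝ × ℝ → ℂ :=
  fourierIntegral Real.fourierChar μ pairing.toLinearMap₁₂ f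

/-- All absolute moments of the measure `f μ` are finite. -/
structure HasMoments (μ : Measure (ℝ × ℝ)) (f : ℝ × ℝ → ℂ) : Prop where
  aestronglyMeasurable : AEStronglyMeasurable f μ
  integrable_moment (n : ℕ) : Integrable (fun v => ‖v‖ ^ n * ‖f v‖) μ

namespace HasMoments

variable {μ : Measure (ℝ × ℝ)} {f : ℝ × ℝ → ℂ}

theorem integrable (h : HasMoments μ f) : Integrable f μ := by
  refine (integrable_norm_iff h.aestronglyMeasurable).1 ?_
  simpa using h.integrable_moment 0

theorem integrable_norm_mul (h : HasMoments μ f) : Integrable (fun v => ‖v‖ * ‖f v‖) μ := by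
  simpa using h.integrable_moment 1

theorem contDiff (h : HasMoments μ f) : ContDiff ℝ ∞ (planeFourier μ f) :=
  contDiff_fourierIntegral pairing fun n _ => h.integrable_moment n

/-- Multiplication by the symbol of the derivative in the direction `e`. -/
theorem symbol_mul (h : HasMoments μ f) (e : ℝ × ℝ) :
    HasMoments μ fun v => fourierSMulRight pairing f v e := by
  have hm : AEStronglyMeasurable (fun v => fourierSMulRight pairing f v e) μ :=
    (ContinuousLinearMap.apply ℝ ℂ e).continuous.comp_aestronglyMeasurable
      (h.aestronglyMeasurable.fourierSMulRight (L := pairing))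
  refine ⟨hm, fun n => ?_⟩
  refine ((h.integrable_moment (n + 1)).const_mul (2 * Real.pi * ‖pairing‖ * ‖e‖)).mono'
    ((continuous_norm.pow n).aestronglyMeasurable.mul hm.norm) (ae_of_all _ fun v => ?_)
  have h1 := ContinuousLinearMap.le_of_opNorm_le _ (norm_fourierSMulRight_le pairing f v) e
  rw [Real.norm_of_nonneg (by positivity)]
  calc ‖v‖ ^ n * ‖fourierSMulRight pairing f v e‖
      ≤ ‖v‖ ^ n * (2 * Real.pi * ‖pairing‖ * ‖v‖ * ‖f v‖ * ‖e‖) := by gcongr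
    _ = _ := by ring

theorem fderiv_planeFourier (h : HasMoments μ f) (w e : ℝ × ℝ) :
    fderiv ℝ (planeFourier μ f) w e =
      planeFourier μ (fun v => fourierSMulRight pairing f v e) w := by
  have hi : Integrable (fourierSMulRight pairing f) μ := by
    refine (h.integrable_norm_mul.const_mul (2 * Real.pi * ‖pairing‖)).mono'
      h.aestronglyMeasurable.fourierSMulRight (ae_of_all _ fun v => ?_)
    exact (norm_fourierSMulRight_le pairing f v).trans (le_of_eq (by ring))
  unfold planeFourier
  rw [fderiv_fourierIntegral pairing h.integrable h.integrable_norm_mul]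
  exact Real.fourierIntegral_continuousLinearMap_apply' hi

theorem fderiv_re_planeFourier (h : HasMoments μ f) (w e : ℝ × ℝ) :
    fderiv ℝ (fun q => (planeFourier μ f q).re) w e =
      (planeFourier μ (fun v => fourierSMulRight pairing f v e) w).re := by
  have hd := (h.contDiff.differentiable (by norm_num) w).hasFDerivAt
  have := (Complex.reCLM.hasFDerivAt.comp w hd).fderiv
  rw [← h.fderiv_planeFourier]
  exact congrArg (fun T : ℝ × ℝ →L[ℝ] ℝ => T e) this

theorem contDiff_re (h : HasMoments μ f) : ContDiff ℝ ∞ fun q => (planeFourier μ f q).re :=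
  Complex.reCLM.contDiff.comp h.contDiff

/-- The Fourier transform of a measure carried by the mass hyperbola solves the Klein-Gordon
equation. -/
theorem box_re_planeFourier (h : HasMoments μ f) {m : ℝ}
    (hμ : ∀ᵐ v ∂μ, (2 * Real.pi) ^ 2 * (v.1 ^ 2 - v.2 ^ 2) = m ^ 2) (q : ℝ × ℝ) :
    dt (dt fun q => (planeFourier μ f q).re) q - dx (dx fun q => (planeFourier μ f q).re) q
      + m ^ 2 * (planeFourier μ f q).re = 0 := by
  have h1 : dt (fun q => (planeFourier μ f q).re) = fun q =>
      (planeFourier μ (fun v => fourierSMulRight pairing f v (1, 0)) q).re :=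
    funext fun w => h.fderiv_re_planeFourier w _
  have h2 : dx (fun q => (planeFourier μ f q).re) = fun q =>
      (planeFourier μ (fun v => fourierSMulRight pairing f v (0, 1)) q).re :=
    funext fun w => h.fderiv_re_planeFourier w _
  rw [h1, h2, dt, dx, (h.symbol_mul (1, 0)).fderiv_re_planeFourier,
    (h.symbol_mul (0, 1)).fderiv_re_planeFourier]
  set ft : ℝ × ℝ → ℂ := fun v =>
    fourierSMulRight pairing (fun v => fourierSMulRight pairing f v (1, 0)) v (1, 0) with hft
  set fx : ℝ × ℝ → ℂ := fun v =>
    fourierSMulRight pairing (fun v => fourierSMulRight pairing f v (0, 1)) v (0, 1) with hfx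
  have hix : Integrable fx μ := ((h.symbol_mul _).symbol_mul _).integrable
  -- The two second derivatives have symbols `-(2π)² v.1²` and `-(2π)² v.2²`, which differ by `-m²`
  -- on the hyperbola.
  have hae : ft =ᵐ[μ] fx + (-(m : ℂ) ^ 2) • f := by
    filter_upwards [hμ] with v hv
    simp only [hft, hfx, fourierSMulRight_apply, pairing_apply, Pi.add_apply, Pi.smul_apply,
      smul_eq_mul, Complex.real_smul]
    rw [← Complex.ofReal_pow, ← hv]
    push_cast
    linear_combination (2 * Real.pi) ^ 2 * ((v.1 : ℂ) ^ 2 - (v.2 : ℂ) ^ 2) * f v * Complex.I_sq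
  have hsum : planeFourier μ ft q = planeFourier μ fx q + (-(m : ℂ) ^ 2) * planeFourier μ f q := by
    have hadd := fourierIntegral_add (L := pairing.toLinearMap₁₂) Real.continuous_fourierChar
      pairing.continuous₂ hix (h.integrable.smul (-(m : ℂ) ^ 2))
    rw [fourierIntegral_const_smul] at hadd
    unfold planeFourier
    rw [fourierIntegral_congr_ae _ _ _ hae, hadd]
    rfl
  have hre := congrArg Complex.re hsum
  rw [← Complex.ofReal_pow, ← Complex.ofReal_neg, Complex.add_re, Complex.re_ofReal_mul] at hre
  linarith

end HasMoments

/-- Frequency (in cycles per unit time) of the plane wave with wave number `ξ` (in cycles per unit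
length) of a Klein-Gordon field of mass `m`. -/
def frequency (m ξ : ℝ) : ℝ := Real.sqrt (ξ ^ 2 + (m / (2 * Real.pi)) ^ 2)

theorem continuous_hyperbola (m : ℝ) : Continuous fun ξ : ℝ => (frequency m ξ, ξ) := by
  unfold frequency; fun_prop

/-- The measure `dξ` on the upper branch of the mass hyperbola. -/
def hyperbolaMeasure (m : ℝ) : Measure (ℝ × ℝ) :=
  Measure.map (fun ξ : ℝ => (frequency m ξ, ξ)) volume

/-- Linear growth in `ξ` lets Schwartz decay in `ξ` bound every moment on the hyperbola. -/
theorem norm_hyperbola_le (m ξ : ℝ) : ‖((frequency m ξ, ξ) : ℝ × ℝ)‖ ≤ |ξ| + |m / (2 * Real.pi)| := by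
  have h0 : 0 ≤ |m / (2 * Real.pi)| := abs_nonneg _
  refine max_le ?_ (by simp)
  simp only [frequency]
  rw [Real.norm_of_nonneg (Real.sqrt_nonneg _)]
  refine Real.sqrt_le_iff.2 ⟨by positivity, ?_⟩
  rw [← sq_abs ξ, ← sq_abs (m / _)]
  nlinarith [mul_nonneg (abs_nonneg ξ) h0]

theorem hasMoments_hyperbolaMeasure (m : ℝ) (g : 𝓢(ℝ, ℂ)) :
    HasMoments (hyperbolaMeasure m) fun v => g v.2 := by
  have hg : Continuous fun v : ℝ × ℝ => g v.2 := g.continuous.comp continuous_snd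
  refine ⟨hg.aestronglyMeasurable, fun n => ?_⟩
  rw [hyperbolaMeasure, integrable_map_measure
    (Continuous.aestronglyMeasurable (by fun_prop)) (continuous_hyperbola m).aemeasurable]
  refine (((g.integrable_pow_mul volume n).add
    ((g.integrable_pow_mul volume 0).const_mul (|m / (2 * Real.pi)| ^ n))).const_mul
      (2 ^ (n - 1))).mono' (Continuous.aestronglyMeasurable ?_) (ae_of_all _ fun ξ => ?_)
  · have h1 := continuous_hyperbola m
    exact ((h1.norm.pow n).mul g.continuous.norm)
  · simp only [Function.comp_apply, Pi.add_apply, pow_zero, one_mul, Real.norm_eq_abs ξ]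
    rw [Real.norm_of_nonneg (by positivity), ← add_mul, ← mul_assoc]
    gcongr
    exact (pow_le_pow_left₀ (norm_nonneg _) (norm_hyperbola_le m ξ) n).trans
      (add_pow_le (abs_nonneg _) (abs_nonneg _) n)

theorem ae_hyperbolaMeasure (m : ℝ) :
    ∀ᵐ v ∂hyperbolaMeasure m, (2 * Real.pi) ^ 2 * (v.1 ^ 2 - v.2 ^ 2) = m ^ 2 := by
  refine (ae_map_iff (continuous_hyperbola m).aemeasurable
    (isClosed_eq (by fun_prop) continuous_const).measurableSet).2 (ae_of_all _ fun ξ => ?_)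
  simp only [frequency]
  rw [Real.sq_sqrt (by positivity)]
  field_simp
  ring

/-- At `t = 0` the phase sees only `ξ`, and the hyperbola carries plain `dξ`. Fourier inversion can
therefore match the initial value. -/
theorem planeFourier_hyperbolaMeasure_zero (m : ℝ) (g : 𝓢(ℝ, ℂ)) (x : ℝ) :
    planeFourier (hyperbolaMeasure m) (fun v => g v.2) (0, x) = 𝓕 (g : ℝ → ℂ) x := by
  rw [planeFourier, fourierIntegral, hyperbolaMeasure, integral_map
    (continuous_hyperbola m).aemeasurable, Real.fourier_real_eq]
  · refine integral_congr_ae (ae_of_all _ fun ξ => ?_)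
    change Real.fourierChar (-(pairing (frequency m ξ, ξ) (0, x))) • g ξ = _
    simp [pairing_apply]
  · refine Continuous.aestronglyMeasurable ?_
    have h1 := Real.continuous_fourierChar
    have h2 := g.continuous
    have h3 : Continuous fun v : ℝ × ℝ => Real.fourierChar (-(pairing v (0, x))) := by fun_prop
    exact h3.smul (h2.comp continuous_snd)

/-- Global smooth solvability of the Cauchy problem with Schwartz initial data at rest. -/
theorem exists_isKleinGordonSolution (m : ℝ) (φ : 𝓢(ℝ, ℝ)) :
    ∃ Ψ : ℝ → ℝ → ℝ, ContDiff ℝ ∞ (onPlane Ψ) ∧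
      IsKleinGordonSolution m φ (fun _ => 0) Ψ := by
  let φc : 𝓢(ℝ, ℂ) := φ.postcompCLM Complex.ofRealCLM
  let g : 𝓢(ℝ, ℂ) := 𝓕⁻ φc
  have hg := hasMoments_hyperbolaMeasure m g
  let u : ℝ × ℝ → ℝ := fun q => (planeFourier (hyperbolaMeasure m) (fun v => g v.2) q).re
  have hu : ContDiff ℝ ∞ u := hg.contDiff_re
  have hsol := IsKleinGordonSolution.of_box (m := m) (u := u) (hu.of_le (by norm_cast))
    (hg.box_re_planeFourier (ae_hyperbolaMeasure m))
  have h0 (x : ℝ) : u (0, x) = φ x := by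
    simp only [u]
    rw [planeFourier_hyperbolaMeasure_zero, ← SchwartzMap.fourier_coe,
      FourierTransform.fourier_fourierInv_eq]
    simp [φc]
  -- Both terms have initial value `φ` and their initial velocities are opposite.
  have havg := hsol.linear_combination (1 / 2) (1 / 2) hsol.reflect
  refine ⟨fun t x => 1 / 2 * u (t, x) + 1 / 2 * u (-t, x), ?_, ?_⟩
  rotate_left
  · convert havg using 2 with x x
    · rw [h0]; ring
    · ring
  · exact (contDiff_const.mul hu).add (contDiff_const.mul
      (hu.comp (contDiff_fst.neg.prodMk contDiff_snd)))

end Existence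

/-! ### Initial data, the monochromatic wave and its invariant. -/

theorem hasTemperateGrowth_cos : Function.HasTemperateGrowth Real.cos := by
  refine ⟨Real.contDiff_cos, fun n => ⟨0, 1, fun x => ?_⟩⟩
  rw [norm_iteratedFDeriv_eq_norm_iteratedDeriv]
  simpa using Real.abs_iteratedDeriv_cos_le_one n x

/-- A Schwartz function times a plane wave, as a Schwartz function. -/
theorem exists_schwartz_mul_cos (χ : 𝓢(ℝ, ℝ)) (a k b : ℝ) :
    ∃ φ : 𝓢(ℝ, ℝ), (φ : ℝ → ℝ) = fun x => χ x * (a * Real.cos (k * x - b)) := by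
  have hlin : Function.HasTemperateGrowth fun x : ℝ => k * x - b := by fun_prop
  have h : Function.HasTemperateGrowth fun x : ℝ => a * Real.cos (k * x - b) :=
    (Function.HasTemperateGrowth.const a).mul (hasTemperateGrowth_cos.comp hlin)
  refine ⟨SchwartzMap.smulLeftCLM ℝ (fun x : ℝ => a * Real.cos (k * x - b)) χ, funext fun x => ?_⟩
  rw [SchwartzMap.smulLeftCLM_apply_apply h, smul_eq_mul, mul_comm]

/-- There are Schwartz cutoff functions. -/
theorem exists_schwartz_cutoff {R : ℝ} (hR : 0 < R) : ∃ χ : 𝓢(ℝ, ℝ), ∀ x, |x| ≤ R → χ x = 1 := by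
  let b : ContDiffBump (0 : ℝ) := ⟨R, R + 1, hR, by linarith⟩
  exact ⟨b.hasCompactSupport.toSchwartzMap b.contDiff, fun x hx =>
    b.one_of_mem_closedBall (by simpa using hx)⟩

theorem hasDerivAt_cos_affine (c k b s : ℝ) :
    HasDerivAt (fun s => c * Real.cos (k * s - b)) (-(c * k) * Real.sin (k * s - b)) s := by
  have := ((((hasDerivAt_id s).const_mul k).sub_const b).cos).const_mul c
  exact this.congr_deriv (by simp; ring)

theorem hasDerivAt_sin_affine (c k b s : ℝ) :
    HasDerivAt (fun s => c * Real.sin (k * s - b)) (c * k * Real.cos (k * s - b)) s := by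
  have := ((((hasDerivAt_id s).const_mul k).sub_const b).sin).const_mul c
  exact this.congr_deriv (by simp; ring)

theorem iteratedDeriv_two_cos_affine (c k b s : ℝ) :
    iteratedDeriv 2 (fun s => c * Real.cos (k * s - b)) s =
      -k ^ 2 * (c * Real.cos (k * s - b)) := by
  rw [iteratedDeriv_succ, iteratedDeriv_one, funext fun s => (hasDerivAt_cos_affine c k b s).deriv,
    (hasDerivAt_sin_affine _ k b s).deriv]
  ring

theorem mono_eq_time (a k w t x : ℝ) :
    mono a k w t x = a * Real.cos (k * x - Real.pi / 4) * Real.cos (w * t - 0) := by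
  simp [mono]

theorem mono_eq_space (a k w t x : ℝ) :
    mono a k w t x = a * Real.cos (w * t) * Real.cos (k * x - Real.pi / 4) := by
  simp only [mono]; ring

theorem isKleinGordonSolution_mono {m a k w : ℝ} (hw : w ^ 2 = k ^ 2 + m ^ 2) :
    IsKleinGordonSolution m (fun x => a * Real.cos (k * x - Real.pi / 4)) (fun _ => 0)
      (mono a k w) where
  contDiff := by unfold mono; fun_prop
  equation t x := by
    have h1 : iteratedDeriv 2 (fun s => mono a k w s x) t = -w ^ 2 * mono a k w t x := by
      simp_rw [mono_eq_time]
      exact iteratedDeriv_two_cos_affine _ _ _ _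
    have h2 : iteratedDeriv 2 (fun r => mono a k w t r) x = -k ^ 2 * mono a k w t x := by
      simp_rw [mono_eq_space]
      exact iteratedDeriv_two_cos_affine _ _ _ _
    rw [h1, h2, hw]
    ring
  init x := by simp [mono]
  init_deriv x := by
    simp_rw [mono_eq_time]
    rw [(hasDerivAt_cos_affine _ _ _ _).deriv]
    simp

/-- Finite energy at all times of a Klein-Gordon field starting at rest from Schwartz data. -/
theorem integrable_energy_of_schwartz {m : ℝ} {φ : 𝓢(ℝ, ℝ)} {Ψ : ℝ → ℝ → ℝ}
    (h : IsKleinGordonSolution m φ (fun _ => 0) Ψ) (t : ℝ) :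
    Integrable fun x => energy m (onPlane Ψ) (t, x) := by
  have hd : Differentiable ℝ (onPlane Ψ) := h.contDiff.differentiable (by norm_num)
  have hΨ0 : (fun x => Ψ 0 x) = φ := funext h.init
  have h0 : Integrable fun x => energy m (onPlane Ψ) (0, x) := by
    have hx (x : ℝ) : dx (onPlane Ψ) (0, x) = SchwartzMap.derivCLM ℝ ℝ φ x := by
      rw [SchwartzMap.derivCLM_apply, ← hΨ0]
      exact (hasDerivAt_snd hd 0 x).deriv.symm
    have he (x : ℝ) : energy m (onPlane Ψ) (0, x) =
        (SchwartzMap.derivCLM ℝ ℝ φ x ^ 2 + m ^ 2 * φ x ^ 2) / 2 := by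
      rw [energy, hx, h.dt_zero, ← hΨ0]
      simp [onPlane]
    simp_rw [he]
    exact ((((SchwartzMap.derivCLM ℝ ℝ φ).memLp 2).integrable_sq).add
      (((φ.memLp 2).integrable_sq).const_mul (m ^ 2))).div_const 2
  have hpos {s : ℝ} (hs : 0 ≤ s) := integrable_energy h.contDiff h.box_eq_zero h0 hs
  rcases le_total 0 t with ht | ht
  · exact hpos ht
  -- Data at rest are invariant under time reversal, so by uniqueness `Ψ` is even in `t`, and so is
  -- its energy density.
  · have heven : (fun s x => Ψ (-s) x) = Ψ := (by simpa using h.reflect :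
      IsKleinGordonSolution m φ (fun _ => 0) fun s x => Ψ (-s) x).unique h
    have hev (s x : ℝ) : Ψ (-s) x = Ψ s x := congrFun (congrFun heven s) x
    convert hpos (neg_nonneg.2 ht) using 2 with x
    have h1 : dx (onPlane Ψ) (-t, x) = dx (onPlane Ψ) (t, x) := by
      rw [← (hasDerivAt_snd hd (-t) x).deriv, ← (hasDerivAt_snd hd t x).deriv]
      simp only [onPlane, hev]
    have h2 : dt (onPlane Ψ) (-t, x) = -dt (onPlane Ψ) (t, x) := by
      rw [← (hasDerivAt_fst hd (-t) x).deriv, ← (hasDerivAt_fst hd t x).deriv]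
      have := deriv_comp_neg (fun s => Ψ s x) t
      simp only [hev] at this
      simp only [onPlane]
      linarith
    simp only [energy, h1, h2, onPlane, hev]
    ring

/-- The invariant at the origin of a field that is monochromatic near `x = 0` for a while. -/
theorem invariant_ansatz_of_eq_mono {m a k w R : ℝ} (hw : w ^ 2 = k ^ 2 + m ^ 2)
    {Ψ : ℝ → ℝ → ℝ} (hΨ : Differentiable ℝ (onPlane Ψ))
    (h : ∀ t x : ℝ, 0 ≤ t → |x| ≤ R - t → Ψ t x = mono a k w t x) {t : ℝ} (ht : 0 ≤ t)
    (htR : t < R) (y z : ℝ) :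
    invariant (ansatz (fun s => m * s) Ψ) ![t, 0, y, z] =
      a ^ 2 / 2 * (k ^ 2 - m ^ 2) * Real.cos (w * t) ^ 2
        - a ^ 2 / 2 * (k ^ 2 + m ^ 2) * Real.sin (w * t) ^ 2 := by
  have hx : dx (onPlane Ψ) (t, 0) =
      -(a * Real.cos (w * t) * k) * Real.sin (k * 0 - Real.pi / 4) := by
    have h1 := hasDerivAt_cos_affine (a * Real.cos (w * t)) k (Real.pi / 4) 0
    have h2 : (fun r => onPlane Ψ (t, r)) =ᶠ[𝓝 0]
        fun r => a * Real.cos (w * t) * Real.cos (k * r - Real.pi / 4) := by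
      filter_upwards [Metric.ball_mem_nhds (0 : ℝ) (sub_pos.2 htR)] with r hr
      rw [← mono_eq_space]
      exact h t r ht (by simpa using (Metric.mem_ball.1 hr).le)
    exact (hasDerivAt_snd hΨ t 0).unique (h1.congr_of_eventuallyEq h2)
  have ht' : dt (onPlane Ψ) (t, 0) =
      -(a * Real.cos (k * 0 - Real.pi / 4) * w) * Real.sin (w * t - 0) := by
    -- A right-hand derivative is used because at `t = 0` the formula for `Ψ` is known only on one
    -- side.
    have h1 := (hasDerivAt_cos_affine (a * Real.cos (k * 0 - Real.pi / 4)) w 0 t).hasDerivWithinAt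
      (s := Ici t)
    have h2 (s : ℝ) (hs : 0 ≤ s) (hsR : s ≤ R) : onPlane Ψ (s, 0) =
        a * Real.cos (k * 0 - Real.pi / 4) * Real.cos (w * s - 0) := by
      rw [← mono_eq_time]
      exact h s 0 hs (by simpa using hsR)
    have h3 : (fun s => onPlane Ψ (s, 0)) =ᶠ[𝓝[Ici t] t]
        fun s => a * Real.cos (k * 0 - Real.pi / 4) * Real.cos (w * s - 0) := by
      filter_upwards [self_mem_nhdsWithin, mem_nhdsWithin_of_mem_nhds (Iio_mem_nhds htR)]
        with s hs hs'
      exact h2 s (ht.trans hs) (le_of_lt hs')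
    exact (uniqueDiffWithinAt_Ici t).eq_deriv _ (hasDerivAt_fst hΨ t 0).hasDerivWithinAt
      (h1.congr_of_eventuallyEq h3 (h2 t ht htR.le))
  rw [invariant_ansatz hΨ]
  simp only [Matrix.cons_val_zero, Matrix.cons_val_one]
  rw [hx, ht', h t 0 ht (by simpa using htR.le), mono, mul_zero, zero_sub, sub_zero, Real.sin_neg,
    Real.cos_neg, Real.sin_pi_div_four, Real.cos_pi_div_four]
  have h2 : Real.sqrt 2 ^ 2 = 2 := Real.sq_sqrt (by norm_num)
  linear_combination (a ^ 2 / 4 * (k ^ 2 - m ^ 2) * Real.cos (w * t) ^ 2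
    - a ^ 2 / 4 * w ^ 2 * Real.sin (w * t) ^ 2) * h2 - a ^ 2 / 2 * Real.sin (w * t) ^ 2 * hw

end ForceFree

end

theorem mainTheorem3 (m ξ₀ a ω₀ R : ℝ) (hm : 0 ≤ m) (hξ : m < ξ₀) (ha : a ≠ 0)
    (hω : ω₀ = Real.sqrt (ξ₀ ^ 2 + m ^ 2)) (hR : Real.pi / (2 * ω₀) < R) :
    (∃ χ : 𝓢(ℝ, ℝ), ∀ x, |x| ≤ R → χ x = 1) ∧
    ∀ χ : 𝓢(ℝ, ℝ), (∀ x, |x| ≤ R → χ x = 1) →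
      ∃ Ψ : ℝ → ℝ → ℝ,
        -- the smooth global solution of the Cauchy problem, unique among `C²` solutions
        ContDiff ℝ ∞ (fun q : ℝ × ℝ => Ψ q.1 q.2) ∧
        ForceFree.IsKleinGordonSolution m
          (fun x => χ x * (a * Real.cos (ξ₀ * x - Real.pi / 4))) (fun _ => 0) Ψ ∧
        (∀ Φ : ℝ → ℝ → ℝ, ForceFree.IsKleinGordonSolution m
          (fun x => χ x * (a * Real.cos (ξ₀ * x - Real.pi / 4))) (fun _ => 0) Φ → Φ = Ψ) ∧
        -- its field is force-free and has finite energy per unit transverse area at all times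
        ForceFree.IsForceFree (ForceFree.ansatz (fun s => m * s) Ψ) ∧
        (∀ t y z : ℝ, ForceFree.energyPerArea (ForceFree.ansatz (fun s => m * s) Ψ) t y z < ⊤) ∧
        -- it is monochromatic in the domain of dependence of `[-R, R]`
        (∀ t x : ℝ, 0 ≤ t → |x| ≤ R - t → Ψ t x = ForceFree.mono a ξ₀ ω₀ t x) ∧
        (∀ t y z : ℝ, 0 ≤ t → t < R →
          ForceFree.invariant (ForceFree.ansatz (fun s => m * s) Ψ) ![t, 0, y, z] =
            a ^ 2 / 2 * (ξ₀ ^ 2 - m ^ 2) * Real.cos (ω₀ * t) ^ 2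
              - a ^ 2 / 2 * (ξ₀ ^ 2 + m ^ 2) * Real.sin (ω₀ * t) ^ 2) ∧
        -- the type at the origin changes from magnetic to electric
        (∀ y z : ℝ,
          0 < ForceFree.invariant (ForceFree.ansatz (fun s => m * s) Ψ) ![0, 0, y, z] ∧
          ForceFree.invariant (ForceFree.ansatz (fun s => m * s) Ψ)
            ![Real.pi / (2 * ω₀), 0, y, z] < 0) := by
  have hξ0 : 0 < ξ₀ := hm.trans_lt hξ
  have hsq : ω₀ ^ 2 = ξ₀ ^ 2 + m ^ 2 := by rw [hω, Real.sq_sqrt (by positivity)]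
  have hω0 : 0 < ω₀ := by rw [hω]; positivity
  have hT : 0 < Real.pi / (2 * ω₀) := by positivity
  refine ⟨ForceFree.exists_schwartz_cutoff (hT.trans hR), fun χ hχ => ?_⟩
  obtain ⟨φ, hφ⟩ := ForceFree.exists_schwartz_mul_cos χ a ξ₀ (Real.pi / 4)
  obtain ⟨Ψ, hsmooth, hsol⟩ := ForceFree.exists_isKleinGordonSolution m φ
  have hdiff : Differentiable ℝ (ForceFree.onPlane Ψ) := hsmooth.differentiable (by norm_num)
  have hmono : ∀ t x : ℝ, 0 ≤ t → |x| ≤ R - t → Ψ t x = ForceFree.mono a ξ₀ ω₀ t x := by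
    intro t x ht hx
    refine hsol.eq_of_data_eq (ForceFree.isKleinGordonSolution_mono hsq) ht (fun y hy => ?_)
      fun _ _ => rfl
    -- The base `[x - t, x + t]` of the backward cone lies in `[-R, R]`, where `χ = 1`.
    have hy' : |y| ≤ R := by
      have := abs_sub_abs_le_abs_sub y x
      linarith
    simp only [hφ, hχ y hy', one_mul]
  have hinv := fun (t y z : ℝ) (ht : 0 ≤ t) (htR : t < R) =>
    ForceFree.invariant_ansatz_of_eq_mono hsq hdiff hmono ht htR y z
  refine ⟨Ψ, hsmooth, hφ ▸ hsol, fun Φ hΦ => hΦ.unique (hφ ▸ hsol),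
    ForceFree.isForceFree_ansatz hsmooth hsol.box_eq_zero, fun t y z => ?_, hmono, hinv,
    fun y z => ⟨?_, ?_⟩⟩
  · simp only [ForceFree.energyPerArea, ForceFree.energyDensity_ansatz hdiff,
      Matrix.cons_val_zero, Matrix.cons_val_one]
    exact (ForceFree.integrable_energy_of_schwartz hsol t).lintegral_lt_top
  · rw [hinv 0 y z le_rfl (hT.trans hR)]
    have h1 : 0 < ξ₀ ^ 2 - m ^ 2 := by nlinarith
    simp only [mul_zero, Real.cos_zero, Real.sin_zero]
    have : 0 < a ^ 2 / 2 * (ξ₀ ^ 2 - m ^ 2) := by positivity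
    linarith
  · rw [hinv _ y z hT.le hR]
    have h1 : ω₀ * (Real.pi / (2 * ω₀)) = Real.pi / 2 := by field_simp
    rw [h1, Real.cos_pi_div_two, Real.sin_pi_div_two]
    have : 0 < a ^ 2 / 2 * (ξ₀ ^ 2 + m ^ 2) := by positivity
    linarith
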